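/- **Setting.** Let $G$ be a group acting faithfully by homeomorphisms on a non-empty, locally compact, perfect Polish space $X$. For $g\in G$ put $\mathrm{supp}(g)=\{x\in X: gx\ne x\}$, and let $\mathrm{Fix}(G)$ be the set of points fixed by all of $G$. Assume that $G$ *hereditarily separates* $X$: $\mathrm{Fix}(G)$ is finite, and for every infinite open $Z\subseteq X$ and every finite $Y\subset Z$, the pointwise stabilizer of $(X\setminus Z)\cup Y$ in $G$ fixes no point of $Z\setminus(Y\cup \mathrm{Fix}(G))$. **Words.** Let $\mathbb F_t$ be the free group on $y_1,\dots,y_t$. For $w\in\mathbb F_t*G$ and $\bar g\in G^t$ let $w(\bar g)\in G$ be the value of $w$ at $y_i=g_i$. A word $w$ is in *standard form* if $w\in\mathbb F_t$ or $w=u_kv_k\cdots u_1v_1$ is a reduced expression with $k\ge 1$, $u_i\in\mathbb F_t$, $v_i\in G\setminus\{1\}$, and $u_i\neq 1$ for $i<k$ ($u_k$ may be trivial). If $w\notin\mathbb F_t$ has reduced form $u_kv_k\cdots u_1v_1u'$ with $u'\in\mathbb F_t$, its *standard conjugate* is $u'u_kv_k\cdots u_1v_1$; if $w\in\mathbb F_t$,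 it is $w$. For $w$ in standard form and $A\subseteq X$ let $\mathcal V_w(A)=\bigcup_{j=1}^k v_j\cdots v_1(A)$ if $w\notin\mathbb F_t$, and $\mathcal V_w(A)=A$ if $w\in\mathbb F_t$. For $w\notin\mathbb F_t$ in standard form let $M_w=\bigcap_{i=1}^{k}v_1^{-1}\cdots v_{i-1}^{-1}(\mathrm{supp}(v_i))$. **Three properties of a word $w$ in standard form.** * For $V\subseteq X$ non-empty, $w$ is *oscillating on $V$* if $w\ne1$ and either $w\in\mathbb F_t$ or $V\cap M_w\neq\emptyset$. It is *oscillating* if it is oscillating on $X$; then $O_w:=X\setminus \mathrm{Fix}(G)$ if $w\in\mathbb F_t$ and $O_w:=M_w$ otherwise. * *Almost oscillating.* Start with $\mathcal P^0=\{X\}$, $w_X=w$. Given $\mathcal P^n$ and the words $w_V$, $V\in\mathcal P^n$: if some $w_V$ is oscillating on $V$, stop. Otherwise let $V\in\mathcal P^n$. If $w_V=1$, keep $V$ and $w_V$. If $w_V=u_kv_k\cdots u_1v_1\ne 1$, then for each $\bar\varepsilon\in\{0,1\}^k$ let $V_{\bar\varepsilon}=V\cap\bigcap_{i=1}^k v_1^{-1}\cdots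 v_{i-1}^{-1}(\mathrm{supp}(v_i)^{\varepsilon_i})$, where $A^1=A$, $A^0=\mathrm{int}(X\setminus A)$; if $V_{\bar\varepsilon}\neq\emptyset$, put $V_{\bar\varepsilon}$ into $\mathcal P^{n+1}$, with $w_{V_{\bar\varepsilon}}$ the standard conjugate of the word obtained from $w_V$ by deleting all $v_i$ with $\varepsilon_i=0$ and reducing in $\mathbb F_t*G$. The word $w$ is *almost oscillating* if it is not oscillating and this procedure stops at some $n\ge1$. Then $O_w$ is the union, over all $V\in\mathcal P^n$ such that $w_V$ is oscillating on $V$, of $V$ if $w_V\in\mathbb F_t$ and of $V\cap M_{w_V}$ otherwise. * $w$ has *non-trivial product of constants* if $w\notin\mathbb F_t$ and $v_k\cdots v_1\neq1$; then $V_w:=\mathrm{supp}(v_k\cdots v_1)$. **Theorem.** Let $w_1,\dots,w_m\in\mathbb F_t*G$ be non-constant words ($w_j\notin G$) with standard conjugates $w_1',\dots,w_m'$ (so $w_j'=w_j$ if $w_j$ is in standard form), and suppose that each $w_j'$ is oscillating, or almost oscillating, or has non-trivial product of constants. Then there is $\bar g\in G^t$ with $w_j(\bar g)\ne1$ for all $j\le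 m$. Moreover, for any non-empty open sets $O_1,\dots,O_m\subseteq X$ such that for each $j$ either $w_j'$ is oscillating or almost oscillating and $O_j\subseteq O_{w_j'}$, or $w_j'$ has non-trivial product of constants and $O_j\subseteq V_{w_j'}$, there is $\bar g=(g_1,\dots,g_t)\in G^t$ with $w_j(\bar g)\neq1$ for all $j\le m$ and $\mathrm{supp}(g_i)\subseteq\bigcup_{j=1}^m\mathcal V_{w_j'}(O_j)$ for $1\le i\le t$. -/

import Mathlib

namespace WordSystem

open Monoid.Coprod

/-- The support of a group element acting on `X`: the set of points it moves. -/
def supp {G : Type*} (X : Type*) [Group G] [MulAction G X] (g : G) : Set X :=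
  {x | g • x ≠ x}

/-- `G` hereditarily separates `X`: it has only finitely many global fixed points, and for every
infinite open `Z` and finite `Y ⊆ Z`, the pointwise stabilizer of `Zᶜ ∪ Y` fixes no point of
`Z` outside `Y` and outside the global fixed points. -/
structure HereditarilySeparates (G X : Type*) [Group G] [TopologicalSpace X] [MulAction G X] :
    Prop where
  finite_fixedPoints : (MulAction.fixedPoints G X).Finite
  separates : ∀ Z : Set X, IsOpen Z → Z.Infinite → ∀ Y : Set X, Y ⊆ Z → Y.Finite →
    ∀ x ∈ Z \ (Y ∪ MulAction.fixedPoints G X), ∃ g ∈ fixingSubgroup G (Zᶜ ∪ Y), g • x ≠ x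

/-- The free product of the free group on the variables `y_1, …, y_t` with `G`, that is, words
with constants from `G`. -/
abbrev Words (t : ℕ) (G : Type*) [Group G] : Type _ :=
  Monoid.Coprod (FreeGroup (Fin t)) G

/-- The value `w(g_1, …, g_t)` of a word under the substitution `y_i = g_i`. -/
def eval {t : ℕ} {G : Type*} [Group G] (g : Fin t → G) : Words t G →* G :=
  Monoid.Coprod.lift (FreeGroup.lift g) (MonoidHom.id G)

/-- `w` is a word in the variables only. -/
def IsVariableWord {t : ℕ} {G : Type*} [Group G] (w : Words t G) : Prop :=
  ∃ u : FreeGroup (Fin t), w = inl u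

/-- `w` is a constant, an element of `G`. -/
def IsConstant {t : ℕ} {G : Type*} [Group G] (w : Words t G) : Prop :=
  ∃ g : G, w = inr g

/-- A list of syllables `[(u_k, v_k), …, (u_1, v_1)]`, in the order in which they are written;
`u_i` is a word in the variables, `v_i` a constant. -/
abbrev Syllables (t : ℕ) (G : Type*) : Type _ := List (FreeGroup (Fin t) × G)

/-- The word `u_k v_k ⋯ u_1 v_1`. -/
def wordOf {t : ℕ} {G : Type*} [Group G] (l : Syllables t G) : Words t G :=
  (l.map fun s => inl s.1 * inr s.2).prod

/-- The expression `u_k v_k ⋯ u_1 v_1` is reduced: all constants are non-trivial, and so are all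
variable parts, except perhaps the leftmost one `u_k`. -/
def IsReducedForm {t : ℕ} {G : Type*} [Group G] (l : Syllables t G) : Prop :=
  (∀ s ∈ l, s.2 ≠ 1) ∧ ∀ s ∈ l.tail, s.1 ≠ 1

/-- `w = u_k v_k ⋯ u_1 v_1` is a reduced expression. By the normal form theorem for free products
there is at most one such list for each `w`; the only variable word which has one is `w = 1`,
with `k = 0`. -/
def HasForm {t : ℕ} {G : Type*} [Group G] (w : Words t G) (l : Syllables t G) : Prop :=
  IsReducedForm l ∧ w = wordOf l

/-- `w'` is the standard conjugate of `w`: if `w` is a variable word, then `w' = w`; otherwise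
write `w` in reduced form as `u_k v_k ⋯ u_1 v_1 u'` with `k ≥ 1`, `u'` a (possibly trivial)
variable word, and `w' = u' u_k v_k ⋯ u_1 v_1`. -/
def IsStandardConj {t : ℕ} {G : Type*} [Group G] (w w' : Words t G) : Prop :=
  (IsVariableWord w ∧ w' = w) ∨
  ∃ (l : Syllables t G) (u' : FreeGroup (Fin t)), l ≠ [] ∧ IsReducedForm l ∧
    w = wordOf l * inl u' ∧ w' = inl u' * wordOf l

/-- The product of constants `v_k ⋯ v_1` of a list of syllables. -/
def constProd {t : ℕ} {G : Type*} [Group G] : Syllables t G → G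
  | [] => 1
  | s :: r => s.2 * constProd r

/-- The set of all `x` such that `v_{i-1} ⋯ v_1 x ∈ supp v_i` for all `i = 1, …, k`. -/
def movedSet {t : ℕ} {G : Type*} (X : Type*) [Group G] [MulAction G X] : Syllables t G → Set X
  | [] => Set.univ
  | s :: r => movedSet X r ∩ {x | constProd r • x ∈ supp X s.2}

/-- The union of the sets `v_i ⋯ v_1 (A)` for `i = 1, …, k`. -/
def translates {t : ℕ} {G X : Type*} [Group G] [MulAction G X] : Syllables t G → Set X → Set X
  | [], _ => ∅
  | s :: r, A => translates r A ∪ (fun x => constProd (s :: r) • x) '' A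

/-- The set `𝒱_w(A)`: the union of the `v_i ⋯ v_1 (A)`, `1 ≤ i ≤ k`, if
`w = u_k v_k ⋯ u_1 v_1`, and `A` itself if `w` is a variable word. -/
def translatesOf {t : ℕ} {G X : Type*} [Group G] [MulAction G X] (w : Words t G) (A : Set X) :
    Set X :=
  {x | (IsVariableWord w ∧ x ∈ A) ∨ ∃ l, HasForm w l ∧ x ∈ translates l A}

/-- `w` is oscillating on `V ⊆ X`: it is non-trivial, and it is a variable word or is of the form
`u_k v_k ⋯ u_1 v_1` and `V` contains a point `x` with `v_{i-1} ⋯ v_1 x ∈ supp v_i` for all `i`. -/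
def OscillatingOn {t : ℕ} {G X : Type*} [Group G] [MulAction G X] (V : Set X) (w : Words t G) :
    Prop :=
  w ≠ 1 ∧ (IsVariableWord w ∨ ∃ l, HasForm w l ∧ (V ∩ movedSet X l).Nonempty)

/-- `w` is oscillating (with respect to the action on `X`). -/
def Oscillating {t : ℕ} {G : Type*} (X : Type*) [Group G] [MulAction G X] (w : Words t G) : Prop :=
  OscillatingOn (Set.univ : Set X) w

/-- The set `O_w` for an oscillating word `w`. -/
def oscSet {t : ℕ} {G : Type*} (X : Type*) [Group G] [MulAction G X] (w : Words t G) : Set X :=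
  {x | (IsVariableWord w ∧ x ∉ MulAction.fixedPoints G X) ∨ ∃ l, HasForm w l ∧ x ∈ movedSet X l}

/-- For a list of syllables with flags `ε_i`, the set of all `x` such that `v_{i-1} ⋯ v_1 x` lies
in `supp v_i` if `ε_i` is true, and in the interior of the complement of `supp v_i` if it is
false, for `i = 1, …, k`. -/
def cell {t : ℕ} {G : Type*} (X : Type*) [Group G] [TopologicalSpace X] [MulAction G X] :
    List ((FreeGroup (Fin t) × G) × Bool) → Set X
  | [] => Set.univ
  | (s, ε) :: r => cell X r ∩
      {x | constProd (r.map Prod.fst) • x ∈ if ε then supp X s.2 else interior (supp X s.2)ᶜ}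

/-- Replace by `1` the constants whose flag is false. -/
def erase {t : ℕ} {G : Type*} [Group G] (l : List ((FreeGroup (Fin t) × G) × Bool)) :
    Syllables t G :=
  l.map fun s => (s.1.1, if s.2 then s.1.2 else 1)

/-- One step of the procedure, from a set `P.1 = V` with its word `P.2 = w_V` to one of the
non-empty sets `Q.1 = V_ε` into which `V` is cut and its word `Q.2`, the standard conjugate of the
word obtained from `w_V` by deleting the constants `v_i` with `ε_i = 0`. -/
def Refines {t : ℕ} {G X : Type*} [Group G] [TopologicalSpace X] [MulAction G X]
    (P Q : Set X × Words t G) : Prop :=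
  ∃ l : List ((FreeGroup (Fin t) × G) × Bool), HasForm P.2 (l.map Prod.fst) ∧
    Q.1 = P.1 ∩ cell X l ∧ Q.1.Nonempty ∧ IsStandardConj (wordOf (erase l)) Q.2

/-- The pairs `(V, w_V)` with `V` in the family `𝒫^n` of the procedure started with `w` on `X`. -/
def stage {t : ℕ} {G : Type*} (X : Type*) [Group G] [TopologicalSpace X] [MulAction G X]
    (w : Words t G) : ℕ → Set (Set X × Words t G)
  | 0 => {(Set.univ, w)}
  | n + 1 => {Q | ∃ P ∈ stage X w n, Refines P Q}

/-- The procedure started with `w` stops at stage `n` because an oscillating word has appeared: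
`n` is the first stage at which some `w_V` is oscillating on its `V`. -/
def StopsAt {t : ℕ} {G : Type*} (X : Type*) [Group G] [TopologicalSpace X] [MulAction G X]
    (w : Words t G) (n : ℕ) : Prop :=
  (∃ P ∈ stage X w n, OscillatingOn P.1 P.2) ∧
    ∀ i < n, ∀ P ∈ stage X w i, ¬ OscillatingOn P.1 P.2

/-- `w` is almost oscillating: it is not oscillating (stage `0`), but the procedure reaches a
stage with an oscillating word. -/
def AlmostOscillating {t : ℕ} {G : Type*} (X : Type*) [Group G] [TopologicalSpace X]
    [MulAction G X] (w : Words t G) : Prop :=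
  ∃ n, 0 < n ∧ StopsAt X w n

/-- The set `O_w` for an almost oscillating word `w`: the union over the `V` whose word `w_V` is
oscillating on `V`, at the stage where the procedure stops, of `V` if `w_V` is a variable word, and
of the set of `x ∈ V` with `v_{i-1} ⋯ v_1 x ∈ supp v_i` for all `i` if
`w_V = u_k v_k ⋯ u_1 v_1`. -/
def almostOscSet {t : ℕ} {G : Type*} (X : Type*) [Group G] [TopologicalSpace X] [MulAction G X]
    (w : Words t G) : Set X :=
  {x | ∃ n, StopsAt X w n ∧ ∃ P ∈ stage X w n, OscillatingOn P.1 P.2 ∧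
    x ∈ P.1 ∧ (IsVariableWord P.2 ∨ ∃ l, HasForm P.2 l ∧ x ∈ movedSet X l)}

/-- The product of the constants of `w` in their order, `v_k ⋯ v_1`: the image of `w` under the
homomorphism to `G` which kills all variables and fixes `G`. -/
def productOfConstants {t : ℕ} {G : Type*} [Group G] (w : Words t G) : G :=
  Monoid.Coprod.snd w

/-- `O` is an open non-empty subset of the set `O_w` (if `w` is oscillating or almost oscillating)
or `V_w` (if `w` has non-trivial product of constants) in which `w` can be treated. -/
def IsAdmissible {t : ℕ} {G X : Type*} [Group G] [TopologicalSpace X] [MulAction G X]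
    (w : Words t G) (O : Set X) : Prop :=
  IsOpen O ∧ O.Nonempty ∧
    ((Oscillating X w ∧ O ⊆ oscSet X w) ∨ (AlmostOscillating X w ∧ O ⊆ almostOscSet X w) ∨
      (productOfConstants w ≠ 1 ∧ O ⊆ supp X (productOfConstants w)))

end WordSystem

/-! Let a word act on pairs (q, c), where q is a point and c lies in the free group on variables
marked by points: a constant moves q, and y_i multiplies c on the left by the letter (q, i). This is
`wordPerm`; the word is active at x if it moves (x, 1). Each of the three properties forces activity
on the prescribed sets (`IsAdmissible.subset_activeSet`). A non-trivial product of constants moves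
q. Along an oscillating trajectory consecutive marks differ, so the marked word cannot cancel
(`movedSet_subset_activeSet`). A deletion in the procedure concerns a constant fixing the current
point, so it does not change the action there (`wordPerm_wordOf_erase`). Conversely, activity on a
non-empty open set suffices (`exists_eval_wordOf_ne_one`). Over a small open U, two partial products
v_i ⋯ v_1 either agree or send U to disjoint sets, so the variables can be prescribed independently
on the distinct translates of U. On U the word then acts as v_k ⋯ v_1 after the value of the marked
word at elements supported in U, and `exists_lift_ne_one` makes that value non-trivial whenever the
marked word is. For several words the open sets are shrunk until their translates are disjoint, and
the solutions are glued. -/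

namespace WordSystem

/-! ### Supports and the separation property -/

section Separation

variable {G X : Type*} [Group G] [MulAction G X]

theorem smul_mem_of_supp_subset {g : G} {U : Set X} (hg : supp X g ⊆ U) {x : X} (hx : x ∈ U) :
    g • x ∈ U := by
  by_cases h : g • x = x
  · rwa [h]
  · exact hg fun h' => h (MulAction.injective g h')

theorem smul_eq_of_supp_subset {g : G} {U : Set X} (hg : supp X g ⊆ U) {x : X} (hx : x ∉ U) :
    g • x = x := by
  by_contra h
  exact hx (hg h)

theorem supp_one : supp X (1 : G) = ∅ := by
  ext x; simp [supp]

theorem supp_inv (g : G) : supp X g⁻¹ = supp X g := by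
  ext x
  exact not_congr (inv_smul_eq_iff.trans eq_comm)

theorem supp_mul_subset {g h : G} {U : Set X} (hg : supp X g ⊆ U) (hh : supp X h ⊆ U) :
    supp X (g * h) ⊆ U := by
  intro x hx
  by_contra hxU
  exact hx (by rw [mul_smul, smul_eq_of_supp_subset hh hxU, smul_eq_of_supp_subset hg hxU])

theorem smul_notMem_fixedPoints {x : X} (hx : x ∉ MulAction.fixedPoints G X) (g : G) :
    g • x ∉ MulAction.fixedPoints G X := by
  intro h
  refine hx fun k => ?_
  have h1 := h g⁻¹
  have h2 := h (k * g⁻¹)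
  rw [inv_smul_smul] at h1
  rw [mul_smul, inv_smul_smul, ← h1] at h2
  exact h2

variable [TopologicalSpace X]

/-- The pointwise stabilizer of the complement of an infinite open set and of a finite set `Y`
moves each of the remaining non-fixed points out of any given finite set. -/
theorem HereditarilySeparates.exists_smul_notMem (hsep : HereditarilySeparates G X) {U : Set X}
    (hU : IsOpen U) (hUinf : U.Infinite) {Y B : Set X} (hY : Y.Finite) (hB : B.Finite) {p : X}
    (hpU : p ∈ U) (hpY : p ∉ Y) (hpF : p ∉ MulAction.fixedPoints G X) :
    ∃ h : G, supp X h ⊆ U ∧ (∀ y ∈ Y, h • y = y) ∧ h • p ∉ B := by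
  by_contra! hcon
  set K : Set G := {h | supp X h ⊆ U ∧ ∀ y ∈ Y, h • y = y}
  set O : Set X := (fun h : G => h • p) '' K
  have hO : O.Finite := hB.subset (by
    rintro _ ⟨h, hh, rfl⟩
    exact hcon h hh.1 hh.2)
  have hOU : O ⊆ U := by
    rintro _ ⟨h, hh, rfl⟩
    exact smul_mem_of_supp_subset hh.1 hpU
  -- If the orbit O of p under K were finite, all of it except p could be fixed too. An h that still
  -- moves p sends it to a point of O which h fixes, contradicting injectivity.
  obtain ⟨h, hh, hhp⟩ := hsep.separates U hU hUinf ((Y ∩ U) ∪ (O \ {p}))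
    (Set.union_subset Set.inter_subset_right (Set.sdiff_subset.trans hOU))
    ((hY.inter_of_left U).union hO.sdiff) p ⟨hpU, by
      rintro ((h | h) | h)
      · exact hpY h.1
      · exact h.2 rfl
      · exact hpF h⟩
  rw [mem_fixingSubgroup_iff] at hh
  have hsupp : supp X h ⊆ U := by
    intro x hx
    by_contra hxU
    exact hx (hh x (Or.inl hxU))
  have hfix : ∀ y ∈ Y, h • y = y := by
    intro y hy
    by_cases hyU : y ∈ U
    · exact hh y (Or.inr (Or.inl ⟨hy, hyU⟩))
    · exact hh y (Or.inl hyU)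
  have hmem : h • p ∈ O := ⟨h, ⟨hsupp, hfix⟩, rfl⟩
  exact hhp (MulAction.injective h (hh _ (Or.inr (Or.inr ⟨hmem, hhp⟩))))

end Separation

/-! ### Free group words have no identities in the elements supported in an open set -/

section FreeWords

variable {G X : Type*} [Group G] [MulAction G X] {α : Type*}

/-- The value of a not necessarily reduced word in the variables. -/
def wordValue (a : α → G) (L : List (α × Bool)) : G :=
  (L.map fun s => cond s.2 (a s.1) (a s.1)⁻¹).prod

/-- The data of a trajectory of the point `p₀` under the word `L`, whose letters are substituted
by `a`: `T` is the finite set of the values of letters which the trajectory uses, `p` is the end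
point, and `p` occurs in `T` only where it must. -/
structure IsTrajectory (U : Set X) (p₀ : X) (L : List (α × Bool)) (a : α → G)
    (T : Set (α × X × X)) (p : X) : Prop where
  supp_subset : ∀ s, supp X (a s) ⊆ U
  finite : T.Finite
  smul_eq : ∀ e ∈ T, a e.1 • e.2.1 = e.2.2
  wordValue_eq : ∀ b : α → G, (∀ e ∈ T, b e.1 • e.2.1 = e.2.2) → wordValue b L • p₀ = p
  mem : p ∈ U
  notMem_fixedPoints : p ∉ MulAction.fixedPoints G X
  head_of_source : ∀ e ∈ T, e.2.1 = p → L.head? = some (e.1, false)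
  head_of_target : ∀ e ∈ T, e.2.2 = p → L.head? = some (e.1, true)
  ne_start : L ≠ [] → p ≠ p₀

variable [TopologicalSpace X]

/-- The word is read from the right, and each new letter is adjusted so that the trajectory reaches
a point not met before. This is compatible with the earlier choices because the word is reduced: the
current end point is not yet a source (or target, for an inverse letter) of the letter to be
applied. -/
theorem HereditarilySeparates.exists_isTrajectory (hsep : HereditarilySeparates G X) {U : Set X}
    (hU : IsOpen U) (hUinf : U.Infinite) {p₀ : X} (hp₀ : p₀ ∈ U)
    (hp₀F : p₀ ∉ MulAction.fixedPoints G X) (L : List (α × Bool)) (hL : FreeGroup.IsReduced L) :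
    ∃ (a : α → G) (T : Set (α × X × X)) (p : X), IsTrajectory U p₀ L a T p := by
  classical
  induction L with
  | nil =>
    refine ⟨fun _ => 1, ∅, p₀, ?_, Set.finite_empty, by simp, by simp [wordValue], hp₀, hp₀F,
      by simp, by simp, by simp⟩
    simp [supp_one]
  | cons x L ih =>
    obtain ⟨s, ε⟩ := x
    obtain ⟨a, T, p, hT⟩ := ih (hL.infix ⟨[(s, ε)], [], by simp⟩)
    have hhead : L.head? ≠ some (s, !ε) := by
      intro h
      cases L with
      | nil => simp at h
      | cons y L =>
        have h1 : y = (s, !ε) := by simpa using h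
        subst h1
        have := (FreeGroup.isReduced_cons_cons.mp hL).1 rfl
        cases ε <;> simp at this
    set pts : Set X := (fun e : α × X × X => e.2.1) '' T ∪ (fun e : α × X × X => e.2.2) '' T
    have hpts : pts.Finite := (hT.finite.image _).union (hT.finite.image _)
    set c : G := cond ε (a s) (a s)⁻¹ with hc
    have hcU : supp X c ⊆ U := by
      cases ε
      · simpa [hc, supp_inv] using hT.supp_subset s
      · simpa [hc] using hT.supp_subset s
    -- The perturbation h fixes every recorded point other than p. The forbidden set is pulled back
    -- by c because it is c • h • p that has to be new.
    obtain ⟨h, hhU, hhY, hhp⟩ := hsep.exists_smul_notMem hU hUinf (Y := pts \ {p})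
      (B := (fun x => c⁻¹ • x) '' (pts ∪ {p, p₀})) hpts.sdiff
      ((hpts.union (Set.toFinite _)).image _) hT.mem (by simp) hT.notMem_fixedPoints
    set p' : X := c • h • p with hp'
    have hp'pts : p' ∉ pts ∪ {p, p₀} := fun hmem => hhp ⟨p', hmem, by simp [hp']⟩
    have hp'1 : p' ∉ pts := fun h => hp'pts (Or.inl h)
    have hp'2 : p' ≠ p := fun h => hp'pts (by simp [h])
    have hp'3 : p' ≠ p₀ := fun h => hp'pts (by simp [h])
    have hsrc : ∀ e ∈ T, e.2.1 ≠ p → h • e.2.1 = e.2.1 := fun e he hne =>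
      hhY _ ⟨Or.inl ⟨e, he, rfl⟩, hne⟩
    have htgt : ∀ e ∈ T, e.2.2 ≠ p → h • e.2.2 = e.2.2 := fun e he hne =>
      hhY _ ⟨Or.inr ⟨e, he, rfl⟩, hne⟩
    set k : G := cond ε (c * h) (c * h)⁻¹ with hk
    have hkU : supp X k ⊆ U := by
      cases ε
      · simpa only [hk, cond_false, supp_inv] using supp_mul_subset hcU hhU
      · simpa only [hk, cond_true] using supp_mul_subset hcU hhU
    -- The new value of the letter s keeps its recorded transitions: h acts on their sources if ε is
    -- true and on their targets otherwise, and by `hhead` none of these is p.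
    have hks : ∀ e ∈ T, e.1 = s → k • e.2.1 = e.2.2 := by
      intro e he hes
      have hae := hT.smul_eq e he
      cases ε
      · have hne : e.2.2 ≠ p := fun h' => hhead (by
          rw [hT.head_of_target e he h', hes]; rfl)
        rw [hk, cond_false, inv_smul_eq_iff, mul_smul, htgt e he hne, hc, cond_false,
          eq_inv_smul_iff, ← hes, hae]
      · have hne : e.2.1 ≠ p := fun h' => hhead (by
          rw [hT.head_of_source e he h', hes]; rfl)
        rw [hk, cond_true, mul_smul, hsrc e he hne, hc, cond_true, ← hes, hae]
    have hmem₁ : ∀ e ∈ T, e.2.1 ≠ p' := fun e he h' => hp'1 (Or.inl ⟨e, he, h'⟩)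
    have hmem₂ : ∀ e ∈ T, e.2.2 ≠ p' := fun e he h' => hp'1 (Or.inr ⟨e, he, h'⟩)
    have hval : ∀ b : α → G, (∀ e ∈ T, b e.1 • e.2.1 = e.2.2) → cond ε (b s) (b s)⁻¹ • p = p' →
        wordValue b ((s, ε) :: L) • p₀ = p' := by
      intro b hb hbs
      have := hT.wordValue_eq b hb
      simp only [wordValue, List.map_cons, List.prod_cons, mul_smul] at this ⊢
      rw [this, hbs]
    have hnew : ∀ b : α → G, b (cond ε (s, p, p') (s, p', p)).1 •
        (cond ε (s, p, p') (s, p', p)).2.1 = (cond ε (s, p, p') (s, p', p)).2.2 →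
        cond ε (b s) (b s)⁻¹ • p = p' := by
      intro b hb
      cases ε
      · simpa [inv_smul_eq_iff] using hb.symm
      · simpa using hb
    refine ⟨Function.update a s k, insert (cond ε (s, p, p') (s, p', p)) T, p', ?_,
      hT.finite.insert _, ?_, ?_, ?_, ?_, ?_, ?_, fun _ => hp'3⟩
    · intro r
      by_cases hr : r = s
      · subst hr; simpa using hkU
      · simpa [hr] using hT.supp_subset r
    · intro e he
      rcases he with rfl | he
      · cases ε
        · simp [hk, hp', ← mul_smul]
        · simp [hk, hp', ← mul_smul]
      · by_cases hes : e.1 = s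
        · rw [hes, Function.update_self]
          exact hks e he hes
        · rw [Function.update_of_ne hes]
          exact hT.smul_eq e he
    · intro b hb
      exact hval b (fun e he => hb e (Or.inr he)) (hnew b (hb _ (Or.inl rfl)))
    · exact smul_mem_of_supp_subset hcU (smul_mem_of_supp_subset hhU hT.mem)
    · exact smul_notMem_fixedPoints (smul_notMem_fixedPoints hT.notMem_fixedPoints _) _
    · intro e he hep
      rcases he with rfl | he
      · cases ε
        · simp
        · exact absurd hep (by simpa using hp'2.symm)
      · exact absurd hep (hmem₁ e he)
    · intro e he hep
      rcases he with rfl | he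
      · cases ε
        · exact absurd hep (by simpa using hp'2.symm)
        · simp
      · exact absurd hep (hmem₂ e he)

/-- A non-trivial element of a free group has non-trivial values in `G` at elements supported in
any given infinite open set. -/
theorem HereditarilySeparates.exists_lift_ne_one (hsep : HereditarilySeparates G X) {U : Set X}
    (hU : IsOpen U) (hUinf : U.Infinite) {ω : FreeGroup α} (hω : ω ≠ 1) :
    ∃ a : α → G, (∀ s, supp X (a s) ⊆ U) ∧ FreeGroup.lift a ω ≠ 1 := by
  classical
  obtain ⟨p₀, hp₀, hp₀F⟩ := (hUinf.sdiff hsep.finite_fixedPoints).nonempty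
  obtain ⟨a, T, p, hT⟩ := hsep.exists_isTrajectory hU hUinf hp₀ hp₀F ω.toWord
    FreeGroup.isReduced_toWord
  refine ⟨a, hT.supp_subset, fun h => ?_⟩
  have hne := hT.ne_start (by simpa using hω)
  have hval := hT.wordValue_eq a hT.smul_eq
  rw [← FreeGroup.mk_toWord (x := ω), FreeGroup.lift_mk] at h
  rw [wordValue, h, one_smul] at hval
  exact hne hval.symm

end FreeWords

end WordSystem

namespace WordSystem

/-! ### The action on marked words, and active points -/

section Cocycle

variable {G X : Type*} [Group G] [MulAction G X] {t : ℕ}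

/-- The homomorphism which marks the variables by the point `q`. -/
def mark (t : ℕ) {X : Type*} (q : X) : FreeGroup (Fin t) →* FreeGroup (X × Fin t) :=
  FreeGroup.map fun i => (q, i)

/-- The variable `y_i` acts on `(q, c)` as left multiplication of `c` by the letter `(q, i)`. -/
def variablePerm (X : Type*) (i : Fin t) : Equiv.Perm (X × FreeGroup (X × Fin t)) where
  toFun z := (z.1, FreeGroup.of (z.1, i) * z.2)
  invFun z := (z.1, (FreeGroup.of (z.1, i))⁻¹ * z.2)
  left_inv z := by simp
  right_inv z := by simp

/-- A constant acts on `(q, c)` by moving the point `q`. -/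
def constantPerm (t : ℕ) (G X : Type*) [Group G] [MulAction G X] :
    G →* Equiv.Perm (X × FreeGroup (X × Fin t)) where
  toFun g := (MulAction.toPerm g).prodCongr (Equiv.refl _)
  map_one' := by ext z <;> simp
  map_mul' g h := by ext z <;> simp [mul_smul]

/-- The action of words on pairs of a point and an element of the free group on variables marked
by points. It records at which points the variables of a word are evaluated if each of them is
close to the identity. -/
def wordPerm (X : Type*) [MulAction G X] :
    Words t G →* Equiv.Perm (X × FreeGroup (X × Fin t)) :=
  Monoid.Coprod.lift (FreeGroup.lift (variablePerm X)) (constantPerm t G X)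

theorem wordPerm_inr (g : G) (z : X × FreeGroup (X × Fin t)) :
    wordPerm X (Monoid.Coprod.inr g : Words t G) z = (g • z.1, z.2) := by
  simp only [wordPerm, Monoid.Coprod.lift_apply_inr]
  rfl

theorem wordPerm_inl (u : FreeGroup (Fin t)) (z : X × FreeGroup (X × Fin t)) :
    wordPerm X (Monoid.Coprod.inl u : Words t G) z = (z.1, mark t z.1 u * z.2) := by
  simp only [wordPerm, Monoid.Coprod.lift_apply_inl]
  induction u using FreeGroup.induction_on generalizing z with
  | C1 => simp
  | of i => simp [variablePerm, mark]
  | inv_of i _ => simp [variablePerm, mark, Equiv.Perm.inv_def]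
  | mul u v hu hv => simp [hu, hv, mul_assoc]

theorem wordPerm_mul_right (w : Words t G) (x : X) (c d : FreeGroup (X × Fin t)) :
    wordPerm X w (x, c * d) = ((wordPerm X w (x, c)).1, (wordPerm X w (x, c)).2 * d) := by
  induction w using Monoid.Coprod.induction_on generalizing x c d with
  | inl u => simp [wordPerm_inl, mul_assoc]
  | inr g => simp [wordPerm_inr]
  | mul w w' h h' => simp only [map_mul, Equiv.Perm.mul_apply, h', h]

theorem fst_wordPerm (w : Words t G) (z : X × FreeGroup (X × Fin t)) :
    (wordPerm X w z).1 = productOfConstants w • z.1 := by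
  induction w using Monoid.Coprod.induction_on generalizing z with
  | inl u => simp [wordPerm_inl, productOfConstants]
  | inr g => simp [wordPerm_inr, productOfConstants]
  | mul w w' h h' =>
    simp only [productOfConstants, map_mul, Equiv.Perm.mul_apply, mul_smul] at h h' ⊢
    rw [h, h']

/-- The set of points `x` at which `w` acts non-trivially on `(x, 1)`. -/
def activeSet (X : Type*) [MulAction G X] (w : Words t G) : Set X :=
  {x | wordPerm X w (x, 1) ≠ (x, 1)}

theorem supp_productOfConstants_subset_activeSet (w : Words t G) :
    supp X (productOfConstants w) ⊆ activeSet X w := by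
  intro x hx h
  exact hx (by simpa [fst_wordPerm] using congrArg Prod.fst h)

theorem mark_injective (q : X) : Function.Injective (mark t q) :=
  FreeGroup.map_injective fun _ _ h => (Prod.mk.inj h).2

theorem mem_activeSet_of_isVariableWord {w : Words t G} (hw : IsVariableWord w) (h1 : w ≠ 1)
    (x : X) : x ∈ activeSet X w := by
  obtain ⟨u, rfl⟩ := hw
  intro h
  rw [wordPerm_inl] at h
  have h2 : mark t x u = 1 := by simpa using congrArg Prod.snd h
  refine h1 ?_
  rw [(map_eq_one_iff _ (mark_injective x)).mp h2, map_one]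

/-- Variables do not move the point, and the action commutes with right multiplication in the free
group. So if w fixes (x, 1), it fixes (x, d) for all d, and the conjugate fixes (x, 1). -/
theorem mem_activeSet_conj {w : Words t G} {u : FreeGroup (Fin t)} {x : X}
    (hx : x ∈ activeSet X (Monoid.Coprod.inl u * w * Monoid.Coprod.inl u⁻¹)) :
    x ∈ activeSet X w := by
  intro h
  refine hx ?_
  have h' := wordPerm_mul_right w x 1 (mark t x u⁻¹)
  rw [h, one_mul] at h'
  simp only [map_mul, Equiv.Perm.mul_apply, wordPerm_inl, mul_one, h']
  simp

theorem mem_activeSet_of_isStandardConj {w w' : Words t G} (h : IsStandardConj w w') {x : X}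
    (hx : x ∈ activeSet X w') : x ∈ activeSet X w := by
  rcases h with ⟨-, rfl⟩ | ⟨l, u, -, -, rfl, rfl⟩
  · exact hx
  · refine mem_activeSet_conj (u := u) ?_
    simpa [mul_assoc] using hx

/-- The second component of the action of `wordOf l` on `(x, 1)`. -/
def cocycle (x : X) : Syllables t G → FreeGroup (X × Fin t)
  | [] => 1
  | s :: r => mark t (constProd (s :: r) • x) s.1 * cocycle x r

theorem wordOf_cons (s : FreeGroup (Fin t) × G) (r : Syllables t G) :
    wordOf (s :: r) = Monoid.Coprod.inl s.1 * Monoid.Coprod.inr s.2 * wordOf r := by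
  simp [wordOf]

theorem wordPerm_wordOf (l : Syllables t G) (x : X) :
    wordPerm X (wordOf l) (x, 1) = (constProd l • x, cocycle x l) := by
  induction l with
  | nil => simp [wordOf, constProd, cocycle]
  | cons s r ih =>
    simp [wordOf_cons, ih, wordPerm_inl, wordPerm_inr, constProd, cocycle, mul_smul]

theorem mem_activeSet_wordOf {l : Syllables t G} {x : X} :
    x ∈ activeSet X (wordOf l) ↔ constProd l • x ≠ x ∨ cocycle x l ≠ 1 := by
  rw [activeSet, Set.mem_ofPred_eq, wordPerm_wordOf, ne_eq, Prod.mk.injEq, not_and_or]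

theorem toWord_mark [DecidableEq X] (q : X) (u : FreeGroup (Fin t)) :
    (mark t q u).toWord = u.toWord.map fun e => ((q, e.1), e.2) := by
  conv_lhs => rw [← FreeGroup.mk_toWord (x := u), mark, FreeGroup.map.mk, FreeGroup.toWord_mk]
  refine FreeGroup.IsReduced.reduce_eq ?_
  rw [FreeGroup.IsReduced, List.isChain_map]
  simpa [FreeGroup.IsReduced] using FreeGroup.isReduced_toWord (x := u)

/-- Cancellation at the junction would need two letters with the same mark. -/
theorem toWord_cocycle_cons [DecidableEq X] (s : FreeGroup (Fin t) × G) (r : Syllables t G) (x : X)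
    (h : ∀ e ∈ (cocycle x r).toWord.head?, e.1.1 ≠ constProd (s :: r) • x) :
    (cocycle x (s :: r)).toWord =
      (s.1.toWord.map fun e => ((constProd (s :: r) • x, e.1), e.2)) ++ (cocycle x r).toWord := by
  rw [cocycle, FreeGroup.toWord_mul, toWord_mark]
  refine FreeGroup.IsReduced.reduce_eq ?_
  rw [FreeGroup.IsReduced, List.isChain_append]
  refine ⟨?_, FreeGroup.isReduced_toWord, ?_⟩
  · rw [← toWord_mark]
    exact FreeGroup.isReduced_toWord
  · intro e he f hf hef
    refine absurd ?_ (h f hf)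
    rw [← hef]
    obtain ⟨e', -, rfl⟩ := List.mem_map.mp (List.mem_of_mem_getLast? he)
    rfl

theorem fst_head_toWord_cocycle [DecidableEq X] {l : Syllables t G} {x : X}
    (hl : ∀ s ∈ l, s.1 ≠ 1) (hx : x ∈ movedSet X l) :
    ∀ e ∈ (cocycle x l).toWord.head?, e.1.1 = constProd l • x := by
  induction l with
  | nil => simp [cocycle]
  | cons s r ih =>
    have ih' := ih (fun s' hs' => hl s' (List.mem_cons_of_mem _ hs')) hx.1
    have hne : constProd (s :: r) • x ≠ constProd r • x := by
      simpa [constProd, mul_smul, supp] using hx.2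
    rw [toWord_cocycle_cons s r x fun e he h => hne (h.symm.trans (ih' e he))]
    cases hs : s.1.toWord with
    | nil => exact absurd (FreeGroup.toWord_eq_nil_iff.mp hs) (hl s (by simp))
    | cons e L => simp

theorem cocycle_ne_one {l : Syllables t G} {x : X} (hl0 : l ≠ [])
    (hl : ∀ s ∈ l, s.1 ≠ 1) (hx : x ∈ movedSet X l) : cocycle x l ≠ 1 := by
  classical
  cases l with
  | nil => exact absurd rfl hl0
  | cons s r =>
    have hne : constProd (s :: r) • x ≠ constProd r • x := by
      simpa [constProd, mul_smul, supp] using hx.2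
    intro h
    have h' := toWord_cocycle_cons s r x fun e he h => hne (h.symm.trans
      (fst_head_toWord_cocycle (fun s' hs' => hl s' (List.mem_cons_of_mem _ hs')) hx.1 e he))
    rw [h, FreeGroup.toWord_one, eq_comm, List.append_eq_nil_iff, List.map_eq_nil_iff,
      FreeGroup.toWord_eq_nil_iff] at h'
    exact hl s (by simp) h'.1

theorem movedSet_subset_activeSet {l : Syllables t G} (hl : IsReducedForm l) (hl0 : l ≠ []) :
    movedSet X l ⊆ activeSet X (wordOf l) := by
  intro x hx
  rw [mem_activeSet_wordOf]
  cases l with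
  | nil => exact absurd rfl hl0
  | cons s r =>
    -- A trivial leftmost u_k is dropped. If k = 1, the single constant moves x; otherwise the
    -- remaining syllables all have non-trivial variable parts.
    by_cases hs : s.1 = 1
    · cases r with
      | nil =>
        left
        simpa [constProd, supp] using hx.2
      | cons s' r' =>
        right
        rw [cocycle, hs, map_one, one_mul]
        exact cocycle_ne_one (by simp) hl.2 hx.1
    · right
      refine cocycle_ne_one hl0 ?_ hx
      intro s' hs'
      rcases List.mem_cons.mp hs' with rfl | hs'
      · exact hs
      · exact hl.2 s' hs'

theorem mem_activeSet_of_oscillating {w : Words t G} (hw : w ≠ 1) {x : X}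
    (hx : IsVariableWord w ∨ ∃ l, HasForm w l ∧ x ∈ movedSet X l) : x ∈ activeSet X w := by
  rcases hx with hv | ⟨l, ⟨hl, rfl⟩, hx⟩
  · exact mem_activeSet_of_isVariableWord hv hw x
  · refine movedSet_subset_activeSet hl ?_ hx
    rintro rfl
    exact hw (by simp [wordOf])

variable [TopologicalSpace X]

/-- On a cell every deleted constant fixes the point it would be applied to, so the trajectory of x
and all marks stay the same. -/
theorem wordPerm_wordOf_erase {l : List ((FreeGroup (Fin t) × G) × Bool)} {x : X}
    (hx : x ∈ cell X l) :
    wordPerm X (wordOf (erase l)) (x, 1) = wordPerm X (wordOf (l.map Prod.fst)) (x, 1) := by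
  induction l with
  | nil => rfl
  | cons s r ih =>
    obtain ⟨s, ε⟩ := s
    have ih' := ih hx.1
    have h2 := hx.2
    rw [erase] at ih' ⊢
    rw [List.map_cons, List.map_cons, wordOf_cons, wordOf_cons]
    simp only [map_mul, Equiv.Perm.mul_apply, ih']
    cases ε
    · have h3 : s.2 • constProd (r.map Prod.fst) • x = constProd (r.map Prod.fst) • x := by
        by_contra h
        exact interior_subset h2 h
      simp [wordPerm_wordOf, wordPerm_inr, h3]
    · simp

theorem mem_activeSet_of_refines {P Q : Set X × Words t G} (h : Refines P Q) {x : X}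
    (hx : x ∈ Q.1) (hxQ : x ∈ activeSet X Q.2) : x ∈ P.1 ∧ x ∈ activeSet X P.2 := by
  obtain ⟨l, ⟨-, hP⟩, hQ, -, hstd⟩ := h
  rw [hQ] at hx
  refine ⟨hx.1, ?_⟩
  have := mem_activeSet_of_isStandardConj hstd hxQ
  rw [activeSet, Set.mem_ofPred_eq, wordPerm_wordOf_erase hx.2] at this
  rwa [hP]

theorem mem_activeSet_of_mem_stage {w : Words t G} {n : ℕ} {P : Set X × Words t G}
    (hP : P ∈ stage X w n) {x : X} (hx : x ∈ P.1) (hxP : x ∈ activeSet X P.2) :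
    x ∈ activeSet X w := by
  induction n generalizing P with
  | zero =>
    rw [show P = (Set.univ, w) from hP] at hxP
    exact hxP
  | succ n ih =>
    obtain ⟨Q, hQ, hQP⟩ := hP
    obtain ⟨h1, h2⟩ := mem_activeSet_of_refines hQP hx hxP
    exact ih hQ h1 h2

theorem IsAdmissible.subset_activeSet {w : Words t G} {O : Set X} (hO : IsAdmissible w O) :
    O ⊆ activeSet X w := by
  intro x hx
  rcases hO.2.2 with ⟨hw, hsub⟩ | ⟨-, hsub⟩ | ⟨-, hsub⟩
  · exact mem_activeSet_of_oscillating hw.1 ((hsub hx).imp And.left id)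
  · obtain ⟨n, -, P, hP, hosc, hxP, hxm⟩ := hsub hx
    exact mem_activeSet_of_mem_stage hP hxP (mem_activeSet_of_oscillating hosc.1 hxm)
  · exact supp_productOfConstants_subset_activeSet w (hsub hx)

theorem nonempty_of_mem_stage [Nonempty X] {w : Words t G} {n : ℕ} {P : Set X × Words t G}
    (hP : P ∈ stage X w n) : P.1.Nonempty := by
  cases n with
  | zero =>
    rw [show P = (Set.univ, w) from hP]
    exact Set.univ_nonempty
  | succ n =>
    obtain ⟨Q, -, l, -, -, h, -⟩ := hP
    exact h

end Cocycle

/-! ### Open sets of active points -/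

section Openness

variable {G X : Type*} [Group G] [TopologicalSpace X] [T2Space X] [MulAction G X]
  [ContinuousConstSMul G X] {t : ℕ}

theorem isOpen_supp (g : G) : IsOpen (supp X g) :=
  isOpen_ne_fun (continuous_const_smul g) continuous_id

theorem isOpen_movedSet (l : Syllables t G) : IsOpen (movedSet X l) := by
  induction l with
  | nil => exact isOpen_univ
  | cons s r ih => exact ih.inter ((isOpen_supp s.2).preimage (continuous_const_smul _))

theorem isOpen_cell (l : List ((FreeGroup (Fin t) × G) × Bool)) : IsOpen (cell X l) := by
  induction l with
  | nil => exact isOpen_univ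
  | cons s r ih =>
    refine ih.inter (IsOpen.preimage (continuous_const_smul (constProd (r.map Prod.fst)))
      (t := if s.2 then supp X s.1.2 else interior (supp X s.1.2)ᶜ) ?_)
    split_ifs
    · exact isOpen_supp s.1.2
    · exact isOpen_interior

theorem isOpen_of_mem_stage {w : Words t G} {n : ℕ} {P : Set X × Words t G}
    (hP : P ∈ stage X w n) : IsOpen P.1 := by
  induction n generalizing P with
  | zero =>
    rw [show P = (Set.univ, w) from hP]
    exact isOpen_univ
  | succ n ih =>
    obtain ⟨Q, hQ, l, -, hP, -⟩ := hP
    rw [hP]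
    exact (ih hQ).inter (isOpen_cell l)

theorem OscillatingOn.exists_isOpen_subset_activeSet {V : Set X} (hV : IsOpen V)
    (hV0 : V.Nonempty) {w : Words t G} (hw : OscillatingOn V w) :
    ∃ O ⊆ V, IsOpen O ∧ O.Nonempty ∧ O ⊆ activeSet X w := by
  rcases hw with ⟨h1, hv | ⟨l, hl, hne⟩⟩
  · exact ⟨V, subset_rfl, hV, hV0, fun x _ => mem_activeSet_of_isVariableWord hv h1 x⟩
  · exact ⟨V ∩ movedSet X l, Set.inter_subset_left, hV.inter (isOpen_movedSet l), hne,
      fun x hx => mem_activeSet_of_oscillating h1 (Or.inr ⟨l, hl, hx.2⟩)⟩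

theorem exists_isOpen_subset_activeSet [Nonempty X] [FaithfulSMul G X] {w : Words t G}
    (hw : Oscillating X w ∨ AlmostOscillating X w ∨ productOfConstants w ≠ 1) :
    ∃ O, IsOpen O ∧ O.Nonempty ∧ O ⊆ activeSet X w := by
  rcases hw with hw | ⟨n, -, ⟨P, hP, hosc⟩, -⟩ | hw
  · obtain ⟨O, -, hO⟩ := OscillatingOn.exists_isOpen_subset_activeSet isOpen_univ
      Set.univ_nonempty hw
    exact ⟨O, hO⟩
  · obtain ⟨O, hOP, hO, hO0, hOa⟩ := OscillatingOn.exists_isOpen_subset_activeSet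
      (isOpen_of_mem_stage hP) (nonempty_of_mem_stage hP) hosc
    exact ⟨O, hO, hO0, fun x hx => mem_activeSet_of_mem_stage hP (hOP hx) (hOa hx)⟩
  · refine ⟨supp X (productOfConstants w), isOpen_supp _, ?_,
      supp_productOfConstants_subset_activeSet w⟩
    by_contra h
    refine hw (FaithfulSMul.eq_of_smul_eq_smul (α := X) fun x => ?_)
    rw [one_smul]
    by_contra hx
    exact h ⟨x, hx⟩

end Openness

end WordSystem

namespace WordSystem

/-! ### Gluing elements with disjoint supports -/

section Gluing

variable {G X : Type*} [Group G] [MulAction G X]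

/-- Group elements with disjoint supports can be combined into one. -/
theorem exists_glue {ι : Type*} (s : Finset ι) (A : ι → Set X) (b : ι → G)
    (hb : ∀ i ∈ s, supp X (b i) ⊆ A i) (hA : ∀ i ∈ s, ∀ j ∈ s, i ≠ j → Disjoint (A i) (A j)) :
    ∃ g : G, supp X g ⊆ ⋃ i ∈ s, A i ∧ ∀ i ∈ s, ∀ x ∈ A i, g • x = b i • x := by
  classical
  induction s using Finset.induction_on with
  | empty => exact ⟨1, by simp [supp_one], by simp⟩
  | insert i s his ih =>
    obtain ⟨g, hgs, hg⟩ := ih (fun j hj => hb j (Finset.mem_insert_of_mem hj))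
      fun j hj k hk => hA j (Finset.mem_insert_of_mem hj) k (Finset.mem_insert_of_mem hk)
    have hi := hb i (Finset.mem_insert_self i s)
    have hdisj : ∀ j ∈ s, Disjoint (A i) (A j) := fun j hj =>
      hA i (Finset.mem_insert_self i s) j (Finset.mem_insert_of_mem hj)
        fun h => his (h ▸ hj)
    rw [Finset.set_biUnion_insert]
    refine ⟨b i * g, supp_mul_subset (hi.trans Set.subset_union_left)
      (hgs.trans Set.subset_union_right), fun j hj x hx => ?_⟩
    rw [mul_smul]
    rcases Finset.mem_insert.mp hj with rfl | hj
    · rw [smul_eq_of_supp_subset hgs]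
      simp only [Set.mem_iUnion, not_exists]
      exact fun k hk hxk => Set.disjoint_left.mp (hdisj k hk) hx hxk
    · rw [hg j hj x hx]
      exact smul_eq_of_supp_subset hi fun h => Set.disjoint_left.mp (hdisj j hj) h
        (smul_mem_of_supp_subset (hb j (Finset.mem_insert_of_mem hj)) hx)

theorem supp_lift_subset {α : Type*} {a : α → G} {U : Set X} (ha : ∀ s, supp X (a s) ⊆ U)
    (ω : FreeGroup α) : supp X (FreeGroup.lift a ω) ⊆ U := by
  induction ω using FreeGroup.induction_on with
  | C1 => simp [supp_one]
  | of s => simpa using ha s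
  | inv_of s _ => simpa [supp_inv] using ha s
  | mul u v hu hv => rw [map_mul]; exact supp_mul_subset hu hv

theorem supp_conj_subset {a : G} {U : Set X} (ha : supp X a ⊆ U) (c : G) :
    supp X (c * a * c⁻¹) ⊆ (fun x => c • x) '' U := by
  intro x hx
  refine ⟨c⁻¹ • x, ha fun h => hx ?_, by simp⟩
  rw [mul_smul, mul_smul, h, smul_inv_smul]

end Gluing

/-! ### Evaluating a word through its cocycle -/

section Trajectories

variable {G X : Type*} [Group G] [MulAction G X] {t : ℕ}

theorem mem_translates_iff {l : Syllables t G} {A : Set X} {p : X} :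
    p ∈ translates l A ↔ ∃ r, r <:+ l ∧ r ≠ [] ∧ ∃ x ∈ A, constProd r • x = p := by
  induction l with
  | nil => simp [translates]
  | cons s l ih =>
    simp only [translates, Set.mem_union, ih, Set.mem_image]
    constructor
    · rintro (⟨r, hr, h⟩ | h)
      · exact ⟨r, hr.trans (List.suffix_cons s l), h⟩
      · exact ⟨s :: l, List.suffix_rfl, by simp, h⟩
    · rintro ⟨r, hr, h0, h⟩
      rcases List.suffix_cons_iff.mp hr with rfl | hr
      · exact Or.inr h
      · exact Or.inl ⟨r, hr, h0, h⟩

theorem translates_mono (l : Syllables t G) {A B : Set X} (h : A ⊆ B) :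
    translates l A ⊆ translates l B := by
  intro p hp
  rw [mem_translates_iff] at hp ⊢
  obtain ⟨r, hr, h0, x, hx, rfl⟩ := hp
  exact ⟨r, hr, h0, x, h hx, rfl⟩

theorem lift_smul_smul {g : Fin t → G} {a : X × Fin t → G} {U : Set X}
    (ha : ∀ e, supp X (a e) ⊆ U) {c : G} {q : X}
    (h : ∀ y ∈ U, ∀ i, g i • c • y = c • a (q, i) • y) (u : FreeGroup (Fin t)) {y : X}
    (hy : y ∈ U) :
    FreeGroup.lift g u • c • y = c • FreeGroup.lift a (mark t q u) • y := by
  induction u using FreeGroup.induction_on generalizing y with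
  | C1 => simp
  | of i => simpa [mark] using h y hy i
  | inv_of i _ =>
    have hy' : (a (q, i))⁻¹ • y ∈ U := smul_mem_of_supp_subset (by simpa [supp_inv] using ha _) hy
    simp [mark, inv_smul_eq_iff, h _ hy' i]
  | mul u v hu hv =>
    simp only [map_mul, mul_smul]
    rw [hv hy, hu (smul_mem_of_supp_subset (supp_lift_subset ha _) hy)]

/-- If g i acts on each translate of U as the conjugate of a local element of U, the constants can
all be collected on the left. The local elements are indexed by the image of the base point x, which
is exactly the mark in `cocycle`. -/
theorem eval_wordOf_smul {g : Fin t → G} {a : X × Fin t → G} {U : Set X}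
    (ha : ∀ e, supp X (a e) ⊆ U) {x : X} (l : Syllables t G)
    (h : ∀ r, r <:+ l → r ≠ [] → ∀ y ∈ U, ∀ i,
      g i • constProd r • y = constProd r • a (constProd r • x, i) • y) {y : X} (hy : y ∈ U) :
    eval g (wordOf l) • y = constProd l • FreeGroup.lift a (cocycle x l) • y := by
  induction l with
  | nil => simp [wordOf, constProd, cocycle]
  | cons s r ih =>
    have ih' := ih fun r' hr' => h r' (hr'.trans (List.suffix_cons s r))
    have hr := h (s :: r) List.suffix_rfl (by simp)
    rw [wordOf_cons, map_mul, map_mul, mul_smul, mul_smul, ih']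
    simp only [eval, Monoid.Coprod.lift_apply_inl, Monoid.Coprod.lift_apply_inr,
      MonoidHom.id_apply, cocycle, map_mul, mul_smul]
    rw [← mul_smul s.2, show s.2 * constProd r = constProd (s :: r) from rfl]
    exact lift_smul_smul ha hr _ (smul_mem_of_supp_subset (supp_lift_subset ha _) hy)

open Classical in
/-- The products of constants of the final segments of a list of syllables. -/
noncomputable def suffixProds (l : Syllables t G) : Finset G :=
  (l.tails.map constProd).toFinset

theorem constProd_mem_suffixProds {r l : Syllables t G} (h : r <:+ l) :
    constProd r ∈ suffixProds l := by
  simp only [suffixProds, List.mem_toFinset, List.mem_map, List.mem_tails]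
  exact ⟨r, h, rfl⟩

end Trajectories

/-! ### Shrinking open sets and solving the words -/

section Topological

theorem infinite_of_isOpen {X : Type*} [TopologicalSpace X] [T1Space X] [PerfectSpace X]
    {U : Set X} (hU : IsOpen U) (hU0 : U.Nonempty) : U.Infinite := by
  obtain ⟨x, hx⟩ := hU0
  exact infinite_of_mem_nhds x (hU.mem_nhds hx)

variable {G X : Type*} [Group G] [TopologicalSpace X] [T2Space X] [MulAction G X]
  [ContinuousConstSMul G X] {t : ℕ}

/-- A non-empty open set contains one on which each of finitely many group elements either is
trivial or moves the set off itself. -/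
theorem exists_isOpen_forall_trivial_or_disjoint (C : Finset G) {O : Set X} (hO : IsOpen O)
    (hO0 : O.Nonempty) :
    ∃ U ⊆ O, IsOpen U ∧ U.Nonempty ∧
      ∀ c ∈ C, (∀ x ∈ U, c • x = x) ∨ ∀ x ∈ U, c • x ∉ U := by
  classical
  induction C using Finset.induction_on with
  | empty => exact ⟨O, subset_rfl, hO, hO0, by simp⟩
  | insert c C _ ih =>
    obtain ⟨U, hUO, hU, hU0, hUC⟩ := ih
    by_cases hc : ∀ x ∈ U, c • x = x
    · refine ⟨U, hUO, hU, hU0, fun d hd => ?_⟩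
      rcases Finset.mem_insert.mp hd with rfl | hd
      · exact Or.inl hc
      · exact hUC d hd
    · push Not at hc
      obtain ⟨x, hxU, hx⟩ := hc
      obtain ⟨N, M, hN, hM, hcN, hxM, hNM⟩ := t2_separation hx
      refine ⟨U ∩ (M ∩ (fun x => c • x) ⁻¹' N), Set.inter_subset_left.trans hUO,
        hU.inter (hM.inter (hN.preimage (continuous_const_smul c))), ⟨x, hxU, hxM, hcN⟩,
        fun d hd => ?_⟩
      rcases Finset.mem_insert.mp hd with rfl | hd
      · exact Or.inr fun y hy hy' => Set.disjoint_left.mp hNM hy.2.2 hy'.2.1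
      · exact (hUC d hd).imp (fun h y hy => h y hy.1) fun h y hy hy' => h y hy.1 hy'.1

variable [PerfectSpace X]

/-- Shrink the members of a family of open sets, so that none of finitely many group elements
moves a point of one of them into another one. -/
theorem exists_isOpen_family_smul_notMem {ι : Type*} (T : Finset (ι × ι × G)) {O : ι → Set X}
    (hO : ∀ i, IsOpen (O i)) (hO0 : ∀ i, (O i).Nonempty) :
    ∃ O' : ι → Set X, (∀ i, O' i ⊆ O i) ∧ (∀ i, IsOpen (O' i)) ∧ (∀ i, (O' i).Nonempty) ∧
      ∀ e ∈ T, e.1 ≠ e.2.1 → ∀ x ∈ O' e.1, e.2.2 • x ∉ O' e.2.1 := by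
  classical
  induction T using Finset.induction_on with
  | empty => exact ⟨O, fun _ => subset_rfl, hO, hO0, by simp⟩
  | insert e T _ ih =>
    obtain ⟨i, j, c⟩ := e
    obtain ⟨U, hUO, hU, hU0, hUT⟩ := ih
    by_cases hij : i = j
    · refine ⟨U, hUO, hU, hU0, fun e he hne => ?_⟩
      rcases Finset.mem_insert.mp he with rfl | he
      · exact absurd hij hne
      · exact hUT e he hne
    obtain ⟨x, hx⟩ := hU0 i
    -- Perfectness supplies a point of U j other than c • x, to be separated from it.
    obtain ⟨y, hy, hyx⟩ := (infinite_of_isOpen (hU j) (hU0 j)).exists_notMem_finset {c • x}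
    obtain ⟨N, M, hN, hM, hxN, hyM, hNM⟩ := t2_separation (x := c • x) (y := y)
      (by simpa [eq_comm] using hyx)
    set U' : ι → Set X := Function.update (Function.update U i (U i ∩ (fun x => c • x) ⁻¹' N)) j
      (U j ∩ M) with hU'
    have hU'i : U' i = U i ∩ (fun x => c • x) ⁻¹' N := by simp [hU', hij]
    have hU'j : U' j = U j ∩ M := by simp [hU']
    have hU'k : ∀ k, k ≠ i → k ≠ j → U' k = U k := fun k hi hj => by simp [hU', hi, hj]
    have hsub : ∀ k, U' k ⊆ U k := by
      intro k
      by_cases hki : k = i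
      · rw [hki, hU'i]; exact Set.inter_subset_left
      by_cases hkj : k = j
      · rw [hkj, hU'j]; exact Set.inter_subset_left
      rw [hU'k k hki hkj]
    refine ⟨U', fun k => (hsub k).trans (hUO k), fun k => ?_, fun k => ?_, fun e he hne => ?_⟩
    · by_cases hki : k = i
      · rw [hki, hU'i]; exact (hU i).inter (hN.preimage (continuous_const_smul c))
      by_cases hkj : k = j
      · rw [hkj, hU'j]; exact (hU j).inter hM
      rw [hU'k k hki hkj]; exact hU k
    · by_cases hki : k = i
      · rw [hki, hU'i]; exact ⟨x, hx, hxN⟩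
      by_cases hkj : k = j
      · rw [hkj, hU'j]; exact ⟨y, hy, hyM⟩
      rw [hU'k k hki hkj]; exact hU0 k
    · rcases Finset.mem_insert.mp he with rfl | he
      · intro z hz hz'
        rw [hU'i] at hz
        rw [hU'j] at hz'
        exact Set.disjoint_left.mp hNM hz.2 hz'.2
      · exact fun z hz hz' => hUT e he hne z (hsub _ hz) (hsub _ hz')

/-- Inside an open set in which a word is active, the word has a solution, supported in the
translates of the set, and only its behaviour there matters. -/
theorem HereditarilySeparates.exists_eval_wordOf_ne_one [FaithfulSMul G X]
    (hsep : HereditarilySeparates G X) (l : Syllables t G) {O : Set X} (hO : IsOpen O)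
    (hO0 : O.Nonempty) (hact : O ⊆ activeSet X (wordOf l)) :
    ∃ g : Fin t → G, (∀ i, supp X (g i) ⊆ translates l O) ∧
      ∀ g' : Fin t → G, (∀ i, ∀ p ∈ translates l O, g' i • p = g i • p) →
        eval g' (wordOf l) ≠ 1 := by
  classical
  -- The quotients of partial products are used, so that two partial products either agree on U or
  -- have disjoint images of U.
  obtain ⟨U, hUO, hU, ⟨x, hx⟩, hUC⟩ := exists_isOpen_forall_trivial_or_disjoint
    ((suffixProds l ×ˢ suffixProds l).image fun e => e.1⁻¹ * e.2) hO hO0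
  have hdich : ∀ r r', r <:+ l → r' <:+ l →
      (∀ y ∈ U, constProd r' • y = constProd r • y) ∨
        ∀ y ∈ U, ∀ z ∈ U, constProd r' • y ≠ constProd r • z := by
    intro r r' hr hr'
    refine (hUC ((constProd r)⁻¹ * constProd r') ?_).imp (fun h y hy => ?_) fun h y hy z hz hyz => ?_
    · exact Finset.mem_image.mpr ⟨(constProd r, constProd r'), Finset.mem_product.mpr
        ⟨constProd_mem_suffixProds hr, constProd_mem_suffixProds hr'⟩, rfl⟩
    · have := h y hy
      rwa [mul_smul, inv_smul_eq_iff] at this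
    · refine h y hy ?_
      rwa [mul_smul, hyz, inv_smul_smul]
  have heq : ∀ r r', r <:+ l → r' <:+ l → constProd r' • x = constProd r • x →
      ∀ y ∈ U, constProd r' • y = constProd r • y := fun r r' hr hr' h =>
    (hdich r r' hr hr').resolve_right fun h' => h' x hx x hx h
  have hne : ∀ r r', r <:+ l → r' <:+ l → constProd r' • x ≠ constProd r • x →
      ∀ y ∈ U, ∀ z ∈ U, constProd r' • y ≠ constProd r • z := fun r r' hr hr' h =>
    (hdich r r' hr hr').resolve_left fun h' => h (h' x hx)
  obtain ⟨a, haU, ha⟩ : ∃ a : X × Fin t → G, (∀ e, supp X (a e) ⊆ U) ∧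
      (cocycle x l ≠ 1 → FreeGroup.lift a (cocycle x l) ≠ 1) := by
    by_cases h : cocycle x l = 1
    · exact ⟨fun _ => 1, by simp [supp_one], fun h' => absurd h h'⟩
    · obtain ⟨a, ha, ha'⟩ := hsep.exists_lift_ne_one hU (infinite_of_isOpen hU ⟨x, hx⟩) h
      exact ⟨a, ha, fun _ => ha'⟩
  -- The empty suffix is left out, since every variable is applied after at least v_1; this keeps
  -- the supports inside `translates`.
  set Q : Finset X := (l.tails.toFinset.filter (· ≠ [])).image fun r => constProd r • x with hQ
  have hmemQ : ∀ r, r <:+ l → r ≠ [] → constProd r • x ∈ Q := fun r hr h0 =>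
    Finset.mem_image.mpr ⟨r, by simpa using ⟨hr, h0⟩, rfl⟩
  -- Several suffixes may lead x to the same q. By `heq` they agree on all of U, so any
  -- representative will do; the value [] outside Q is a dummy.
  have hrep : ∀ q : X, ∃ r, q ∈ Q → r <:+ l ∧ r ≠ [] ∧ constProd r • x = q := by
    intro q
    by_cases hq : q ∈ Q
    · obtain ⟨r, hr, hrq⟩ := Finset.mem_image.mp hq
      obtain ⟨h1, h2⟩ := Finset.mem_filter.mp hr
      exact ⟨r, fun _ => ⟨by simpa using h1, h2, hrq⟩⟩
    · exact ⟨[], fun h => absurd h hq⟩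
  choose rep hrep using hrep
  have hglue : ∀ i : Fin t, ∃ g : G, supp X g ⊆ (⋃ q ∈ Q, (fun y => constProd (rep q) • y) '' U) ∧
      ∀ q ∈ Q, ∀ y ∈ (fun y => constProd (rep q) • y) '' U,
        g • y = (constProd (rep q) * a (q, i) * (constProd (rep q))⁻¹) • y := by
    intro i
    refine exists_glue Q _ _ (fun q _ => supp_conj_subset (haU (q, i)) _) ?_
    intro q hq q' hq' hqq'
    obtain ⟨h1, -, h2⟩ := hrep q hq
    obtain ⟨h1', -, h2'⟩ := hrep q' hq'
    rw [Set.disjoint_left]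
    rintro _ ⟨y, hy, rfl⟩ ⟨z, hz, hyz⟩
    exact hne (rep q) (rep q') h1 h1' (by rw [h2, h2']; exact hqq'.symm) z hz y hy hyz
  choose g hgs hg using hglue
  refine ⟨g, fun i => (hgs i).trans ?_, fun g' hg' h => ?_⟩
  · refine Set.iUnion₂_subset fun q hq => ?_
    obtain ⟨h1, h2, -⟩ := hrep q hq
    rintro _ ⟨y, hy, rfl⟩
    exact mem_translates_iff.mpr ⟨rep q, h1, h2, y, hUO hy, rfl⟩
  have hact' : ∀ r, r <:+ l → r ≠ [] → ∀ y ∈ U, ∀ i,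
      g' i • constProd r • y = constProd r • a (constProd r • x, i) • y := by
    intro r hr hr0 y hy i
    have hqQ := hmemQ r hr hr0
    obtain ⟨h1, -, h2⟩ := hrep _ hqQ
    have hry := heq _ r h1 hr h2.symm
    rw [hg' i _ (mem_translates_iff.mpr ⟨r, hr, hr0, y, hUO hy, rfl⟩),
      hg i _ hqQ _ ⟨y, hy, (hry y hy).symm⟩, hry y hy, mul_smul, mul_smul, inv_smul_smul,
      hry _ (smul_mem_of_supp_subset (haU _) hy)]
  have hev : ∀ y ∈ U, constProd l • FreeGroup.lift a (cocycle x l) • y = y := by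
    intro y hy
    rw [← eval_wordOf_smul haU l hact' hy, h, one_smul]
  have hsupp := supp_lift_subset haU (cocycle x l)
  -- Otherwise the product of constants moves U off itself, while `hev` has it send a point of U
  -- back to x.
  have hlx : constProd l • x = x := by
    by_contra hlx
    refine hne [] l (List.nil_suffix) List.suffix_rfl (by simpa [constProd] using hlx) _
      (smul_mem_of_supp_subset hsupp hx) x hx ?_
    rw [hev x hx]
    simp [constProd]
  have hl : ∀ y ∈ U, constProd l • y = y := by
    simpa [constProd] using heq [] l (List.nil_suffix) List.suffix_rfl
      (by simpa [constProd] using hlx)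
  -- As x is active and fixed by the product of constants, its cocycle is non-trivial. But `hev` and
  -- `hl` make the value of the cocycle trivial on U, and it is trivial elsewhere by its support,
  -- against faithfulness.
  refine ha ((mem_activeSet_wordOf.mp (hact (hUO hx))).resolve_left (not_not.mpr hlx))
    (FaithfulSMul.eq_of_smul_eq_smul (α := X) fun y => ?_)
  rw [one_smul]
  by_cases hy : y ∈ U
  · rw [← hl _ (smul_mem_of_supp_subset hsupp hy), hev y hy]
  · exact smul_eq_of_supp_subset hsupp hy

/-- The simultaneous version of `exists_eval_wordOf_ne_one`. -/
theorem HereditarilySeparates.exists_forall_eval_wordOf_ne_one [FaithfulSMul G X]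
    (hsep : HereditarilySeparates G X) {m : ℕ} (l : Fin m → Syllables t G) {O : Fin m → Set X}
    (hO : ∀ j, IsOpen (O j)) (hO0 : ∀ j, (O j).Nonempty)
    (hact : ∀ j, O j ⊆ activeSet X (wordOf (l j))) :
    ∃ g : Fin t → G, (∀ j, eval g (wordOf (l j)) ≠ 1) ∧
      ∀ i, supp X (g i) ⊆ ⋃ j, translates (l j) (O j) := by
  classical
  set P : Finset G := Finset.univ.biUnion fun j => suffixProds (l j)
  have hP : ∀ j r, r <:+ l j → constProd r ∈ P := fun j r hr =>
    Finset.mem_biUnion.mpr ⟨j, Finset.mem_univ j, constProd_mem_suffixProds hr⟩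
  -- Translates of two different sets O' j and O' k meet only if a quotient of partial products
  -- carries a point of one into the other.
  obtain ⟨O', hO'O, hO', hO'0, hO'T⟩ := exists_isOpen_family_smul_notMem
    (Finset.univ ×ˢ Finset.univ ×ˢ ((P ×ˢ P).image fun e => e.1⁻¹ * e.2)) hO hO0
  have hdisj : ∀ j k, j ≠ k →
      Disjoint (translates (l j) (O' j)) (translates (l k) (O' k)) := by
    intro j k hjk
    rw [Set.disjoint_left]
    intro p hp hp'
    obtain ⟨r, hr, -, x, hx, rfl⟩ := mem_translates_iff.mp hp
    obtain ⟨r', hr', -, y, hy, hxy⟩ := mem_translates_iff.mp hp'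
    refine hO'T (j, k, (constProd r')⁻¹ * constProd r) ?_ hjk x hx ?_
    · simp only [Finset.mem_product, Finset.mem_univ, true_and, Finset.mem_image]
      exact ⟨(constProd r', constProd r), ⟨hP k r' hr', hP j r hr⟩, rfl⟩
    · rwa [mul_smul, ← hxy, inv_smul_smul]
  have hsol := fun j => hsep.exists_eval_wordOf_ne_one (l j) (hO' j) (hO'0 j)
    ((hO'O j).trans (hact j))
  choose g hgs hg using hsol
  have hglue := fun i => exists_glue Finset.univ (fun j => translates (l j) (O' j))
    (fun j => g j i) (fun j _ => hgs j i) fun j _ k _ => hdisj j k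
  choose g' hg's hg' using hglue
  refine ⟨g', fun j => hg j g' fun i => hg' i j (Finset.mem_univ j), fun i => (hg's i).trans ?_⟩
  simp only [Finset.mem_univ, Set.iUnion_true]
  exact Set.iUnion_mono fun j => translates_mono _ (hO'O j)

end Topological

/-! ### Passing to standard conjugates -/

section StandardConjugates

variable {G : Type*} [Group G] {t : ℕ}

/-- A standard conjugate is the word of a list of syllables whose translates are those of the
word. -/
theorem IsStandardConj.exists_wordOf_eq (X : Type*) [MulAction G X] {w w' : Words t G}
    (h : IsStandardConj w w') :
    ∃ l, wordOf l = w' ∧ ∀ A : Set X, translates l A ⊆ translatesOf w' A := by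
  rcases h with ⟨hv, rfl⟩ | ⟨l, u', hl0, hl, -, rfl⟩
  · obtain ⟨u, rfl⟩ := hv
    -- A variable word gets one syllable with the dummy constant 1, so that its only translate of A
    -- is A itself; the list need not be reduced.
    refine ⟨[(u, 1)], by simp [wordOf], fun A p hp => Or.inl ⟨⟨u, rfl⟩, ?_⟩⟩
    simpa [translates, constProd] using hp
  · cases l with
    | nil => exact absurd rfl hl0
    | cons s r =>
      have hw : wordOf ((u' * s.1, s.2) :: r) = Monoid.Coprod.inl u' * wordOf (s :: r) := by
        simp [wordOf_cons, mul_assoc]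
      refine ⟨(u' * s.1, s.2) :: r, hw, fun A p hp =>
        Or.inr ⟨(u' * s.1, s.2) :: r, ⟨⟨fun s' hs' => ?_, hl.2⟩, hw.symm⟩, hp⟩⟩
      rcases List.mem_cons.mp hs' with h | hs'
      · rw [h]; exact hl.1 s (by simp)
      · exact hl.1 s' (List.mem_cons_of_mem _ hs')

theorem IsStandardConj.eval_ne_one {w w' : Words t G} (h : IsStandardConj w w') {g : Fin t → G}
    (hg : eval g w' ≠ 1) : eval g w ≠ 1 := by
  rcases h with ⟨-, rfl⟩ | ⟨l, u', -, -, rfl, rfl⟩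
  · exact hg
  · intro h
    rw [map_mul] at h hg
    exact hg (mul_eq_one_comm.mp h)

end StandardConjugates

end WordSystem

theorem theorem2p15 {G X : Type*} [Group G] [TopologicalSpace X] [PolishSpace X]
    [LocallyCompactSpace X] [PerfectSpace X] [Nonempty X]
    [MulAction G X] [FaithfulSMul G X] [ContinuousConstSMul G X]
    (hsep : WordSystem.HereditarilySeparates G X) {t m : ℕ}
    (w w' : Fin m → WordSystem.Words t G)
    (hconst : ∀ j, ¬ WordSystem.IsConstant (w j))
    (hstd : ∀ j, WordSystem.IsStandardConj (w j) (w' j))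
    (hw : ∀ j, WordSystem.Oscillating X (w' j) ∨ WordSystem.AlmostOscillating X (w' j) ∨
      WordSystem.productOfConstants (w' j) ≠ 1) :
    (∃ g : Fin t → G, ∀ j, WordSystem.eval g (w j) ≠ 1) ∧
    ∀ O : Fin m → Set X, (∀ j, WordSystem.IsAdmissible (w' j) (O j)) →
      ∃ g : Fin t → G, (∀ j, WordSystem.eval g (w j) ≠ 1) ∧
        ∀ i, WordSystem.supp X (g i) ⊆ ⋃ j, WordSystem.translatesOf (w' j) (O j) := by
  choose l hl hlt using fun j => (hstd j).exists_wordOf_eq X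
  have key : ∀ O : Fin m → Set X, (∀ j, IsOpen (O j)) → (∀ j, (O j).Nonempty) →
      (∀ j, O j ⊆ WordSystem.activeSet X (w' j)) →
      ∃ g : Fin t → G, (∀ j, WordSystem.eval g (w j) ≠ 1) ∧
        ∀ i, WordSystem.supp X (g i) ⊆ ⋃ j, WordSystem.translatesOf (w' j) (O j) := by
    intro O hO hO0 hact
    obtain ⟨g, hg, hgs⟩ := hsep.exists_forall_eval_wordOf_ne_one l hO hO0
      fun j => by rw [hl j]; exact hact j
    refine ⟨g, fun j => (hstd j).eval_ne_one (by rw [← hl j]; exact hg j), fun i => ?_⟩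
    exact (hgs i).trans (Set.iUnion_mono fun j => hlt j (O j))
  constructor
  · choose O hO hO0 hact using fun j => WordSystem.exists_isOpen_subset_activeSet (hw j)
    obtain ⟨g, hg, -⟩ := key O hO hO0 hact
    exact ⟨g, hg⟩
  · exact fun O hadm => key O (fun j => (hadm j).1) (fun j => (hadm j).2.1)
      fun j => (hadm j).subset_activeSet
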